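/- Let $\alpha>0$ and $0<p\le\infty$. Let $L^p_\alpha$ be the space of all Lebesgue measurable functions $f$ on $\mathbb{C}$ such that $f(z)e^{-\alpha|z|^2/2}$ belongs to $L^p(\mathbb{C},dA)$, where $dA$ is area measure, and let the Fock space $F^p_\alpha$ be the set of all entire functions in $L^p_\alpha$. Let $f$ be an entire function on $\mathbb{C}$ with $f(0)=f'(0)=0$. Then for any constant $c\in\mathbb{C}$ (including $c=0$), $f\in F^p_\alpha$ if and only if the function $$\frac{f'(z)}{z}+c\,\frac{f(z)}{z^2},$$ extended to an entire function across its removable singularity at $z=0$, belongs to $F^p_\alpha$. -/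

import Mathlib

open MeasureTheory
open scoped ENNReal

/-- The weighted space `L^p_α(ℂ)`: all Lebesgue measurable functions `f` on `ℂ` such that
`z ↦ f(z) e^{-α|z|²/2}` belongs to `L^p(ℂ, dv)`, where `dv` is area measure. -/
def weightedLp (α : ℝ) (p : ℝ≥0∞) : Set (ℂ → ℂ) :=
  {f | MemLp (fun z : ℂ => f z * (Real.exp (-(α * ‖z‖ ^ 2 / 2)) : ℂ)) p volume}

/-- The Fock space `F^p_α = L^p_α ∩ H(ℂ)`: the entire functions in `L^p_α`. -/
def fockSpace (α : ℝ) (p : ℝ≥0∞) : Set (ℂ → ℂ) :=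
  weightedLp α p ∩ {f | Differentiable ℂ f}

/-! Write N f(z) = |f(z)| e^{-α|z|²/2} and g = f'/z + c f/z². Subharmonicity, for every exponent q >
0, bounds the supremum of (N f)^q on a unit disc by its integral over the concentric disc of radius
2 (`exists_gaussNorm_bound`). By Tonelli, a local pointwise comparison of N f and N g becomes a
comparison of integrals, also for p < 1.

From f to g: Cauchy's estimate at scale 1/|z|, on which the weight is essentially constant, costs a
factor |z| that the division by z repays.

From g to f: integrate f' = z g - (c/z) f along a radial step of length L/|z|. The weight gains
e^{-αL/2} at the inner endpoint, and the c-term is small for large |z|, so N f(z) is at most a small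
multiple of nearby values of N f plus a multiple of nearby values of N g
(`exists_gaussNorm_le_of_eq_div_id_add`). The small term must be absorbed before N f is known to be
p-integrable. A maximum on a disc first gives boundedness of N f; for p < ∞ an iteration over
growing discs, whose integrals then grow only quadratically, finishes. -/

/-! ### Sub-mean value inequalities for |F|^q -/

/-- The sub-mean value inequality over a circle. -/
theorem enorm_le_lintegral_circleMap {F : ℂ → ℂ} (hF : Differentiable ℂ F) (z : ℂ) (ρ : ℝ) :
    ENNReal.ofReal (2 * Real.pi) * ‖F z‖ₑ ≤
      ∫⁻ θ in Set.Ioo (-Real.pi) Real.pi, ‖F (circleMap z ρ θ)‖ₑ := by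
  have h1 : Real.circleAverage F z ρ = F z := hF.diffContOnCl.circleAverage
  rw [Real.circleAverage_eq_integral_add (-Real.pi),
    intervalIntegral.integral_comp_add_right (fun θ => F (circleMap z ρ θ))] at h1
  have h2 : (2 * Real.pi) • F z = ∫ θ in (-Real.pi)..Real.pi, F (circleMap z ρ θ) := by
    rw [← h1, smul_smul, mul_inv_cancel₀ (by positivity), one_smul]
    congr 1 <;> ring
  have h3 : ENNReal.ofReal (2 * Real.pi) * ‖F z‖ₑ = ‖(2 * Real.pi) • F z‖ₑ := by
    rw [enorm_smul, Real.enorm_eq_ofReal (by positivity)]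
  rw [h3, h2, intervalIntegral.integral_of_le (by linarith [Real.pi_pos]),
    integral_Ioc_eq_integral_Ioo]
  exact enorm_integral_le_lintegral_enorm _

/-- A sub-mean value inequality over a disc. -/
theorem enorm_le_lintegral_ball {F : ℂ → ℂ} (hF : Differentiable ℂ F) (z : ℂ) {r : ℝ}
    (hr : 0 < r) :
    ENNReal.ofReal (r ^ 2) * ‖F z‖ₑ ≤ ∫⁻ w in Metric.ball z r, ‖F w‖ₑ := by
  set u : ℂ → ℝ≥0∞ := (Metric.ball (0 : ℂ) r).indicator fun w => ‖F (z + w)‖ₑ with hu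
  have h1 : ∫⁻ w in Metric.ball z r, ‖F w‖ₑ = ∫⁻ w, u w := by
    rw [← lintegral_indicator Metric.isOpen_ball.measurableSet,
      ← lintegral_add_left_eq_self _ z]
    congr 1
    ext w
    simp only [hu, Set.indicator, Metric.mem_ball, dist_self_add_left, dist_zero_right]
  have hcirc (p : ℝ × ℝ) : z + Complex.polarCoord.symm p = circleMap z p.1 p.2 := by
    simp [circleMap, Complex.exp_mul_I]
  have hcont : Continuous fun p : ℝ × ℝ => F (circleMap z p.1 p.2) :=
    hF.continuous.comp (by unfold circleMap; fun_prop)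
  -- Only the annulus r/2 < ρ < r is kept, where the polar Jacobian is at least r/2. This gives the
  -- constant (r/2)(2π)(r/2) = πr²/2 ≥ r².
  have h2 : ∫⁻ p in Set.Ioo (r / 2) r ×ˢ Set.Ioo (-Real.pi) Real.pi,
      ENNReal.ofReal (r / 2) * ‖F (circleMap z p.1 p.2)‖ₑ ≤ ∫⁻ w, u w := by
    rw [← Complex.lintegral_comp_polarCoord_symm]
    refine le_trans ?_ (lintegral_mono_set (s := Set.Ioo (r / 2) r ×ˢ Set.Ioo (-Real.pi) Real.pi) ?_)
    · refine setLIntegral_mono' (measurableSet_Ioo.prod measurableSet_Ioo) fun p hp => ?_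
      have hp1 := hp.1
      have hmem : Complex.polarCoord.symm p ∈ Metric.ball (0 : ℂ) r := by
        rw [mem_ball_zero_iff, Complex.norm_polarCoord_symm, abs_of_pos (by linarith [hp1.1])]
        exact hp1.2
      rw [hu, Set.indicator_of_mem hmem, hcirc, smul_eq_mul]
      gcongr
      exact hp1.1.le
    · rintro p ⟨hp1, hp2⟩
      exact ⟨(half_pos hr).trans hp1.1, hp2⟩
  rw [h1]
  refine le_trans ?_ h2
  rw [Measure.volume_eq_prod, ← Measure.prod_restrict, lintegral_prod _
    (by exact ((hcont.enorm.measurable).const_mul _).aemeasurable)]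
  calc ENNReal.ofReal (r ^ 2) * ‖F z‖ₑ
      ≤ ENNReal.ofReal (r / 2) * (ENNReal.ofReal (2 * Real.pi) * ‖F z‖ₑ) *
          ENNReal.ofReal (r - r / 2) := by
        rw [← mul_assoc, mul_right_comm, ← ENNReal.ofReal_mul (by positivity),
          ← ENNReal.ofReal_mul (by positivity)]
        gcongr
        nlinarith [Real.pi_gt_three, sq_nonneg r]
    _ = ∫⁻ _ in Set.Ioo (r / 2) r,
          ENNReal.ofReal (r / 2) * (ENNReal.ofReal (2 * Real.pi) * ‖F z‖ₑ) := by
        rw [setLIntegral_const, Real.volume_Ioo]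
    _ ≤ _ := by
        refine lintegral_mono fun ρ => ?_
        rw [lintegral_const_mul' _ _ ENNReal.ofReal_ne_top]
        gcongr
        exact enorm_le_lintegral_circleMap hF z ρ

/-- Local `L^q` control of an entire function for a small exponent `q`. -/
theorem exists_rpow_norm_le_lintegral_ball_of_le_one {q : ℝ} (hq : 0 < q) (hq1 : q ≤ 1) :
    ∃ C : ℝ, 0 < C ∧ ∀ F : ℂ → ℂ, Differentiable ℂ F → ∀ z : ℂ,
      ENNReal.ofReal (‖F z‖ ^ q) ≤
        ENNReal.ofReal C * ∫⁻ w in Metric.ball z 1, ENNReal.ofReal (‖F w‖ ^ q) := by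
  set A : ℝ := 2 ^ (2 / q) with hA
  have hA0 : 0 < A := by positivity
  refine ⟨4 * A ^ (1 - q), by positivity, fun F hF z => ?_⟩
  set I := ∫⁻ w in Metric.ball z 1, ENNReal.ofReal (‖F w‖ ^ q) with hI
  by_cases hItop : I = ⊤
  · rw [hItop, ENNReal.mul_top (by simpa using by positivity)]
    exact le_top
  have hFc := hF.continuous
  -- At a maximum w₀ of φ, at distance d from the boundary, |F| ≤ A|F(w₀)| on the disc of radius d/2
  -- about w₀, so there |F| ≤ (A|F(w₀)|)^(1-q) |F|^q. The exponent 2/q makes the q-th power of the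
  -- cutoff d², matching the area factor in the mean value inequality.
  set φ : ℂ → ℝ := fun w => ‖F w‖ * (1 - ‖w - z‖) ^ (2 / q) with hφ
  have hφc : ContinuousOn φ (Metric.closedBall z 1) := by
    refine hFc.norm.continuousOn.mul (ContinuousOn.rpow_const (by fun_prop) fun w _ => Or.inr ?_)
    positivity
  obtain ⟨w₀, hw₀, hmax⟩ := (isCompact_closedBall z 1).exists_isMaxOn
    ⟨z, Metric.mem_closedBall_self zero_le_one⟩ hφc
  have hmax' : ∀ w ∈ Metric.closedBall z 1, φ w ≤ φ w₀ := fun w hw => hmax hw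
  have hz : ‖F z‖ ≤ φ w₀ := by
    simpa [hφ] using hmax' z (Metric.mem_closedBall_self zero_le_one)
  rw [Metric.mem_closedBall, dist_eq_norm] at hw₀
  set m := ‖F w₀‖ with hm
  set d := 1 - ‖w₀ - z‖ with hd
  have hd0 : 0 ≤ d := by linarith
  have hφ0 : φ w₀ = m * d ^ (2 / q) := rfl
  rw [hφ0] at hmax' hz
  rcases (norm_nonneg (F w₀)).eq_or_lt with hm0 | hm0
  · have : ‖F z‖ = 0 := le_antisymm (by rw [← hm] at hm0; simpa [← hm0] using hz) (norm_nonneg _)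
    rw [this, Real.zero_rpow hq.ne']
    simp
  rw [← hm] at hm0
  rcases hd0.eq_or_lt with hd0 | hd0
  · have : ‖F z‖ = 0 := le_antisymm
      (by rwa [← hd0, Real.zero_rpow (by positivity), mul_zero] at hz) (norm_nonneg _)
    rw [this, Real.zero_rpow hq.ne']
    simp
  have hsub : ∀ w ∈ Metric.ball w₀ (d / 2), ‖w - z‖ < 1 - d / 2 := fun w hw => by
    rw [Metric.mem_ball, dist_eq_norm] at hw
    have := norm_add_le (w - w₀) (w₀ - z)
    rw [sub_add_sub_cancel] at this
    linarith
  have hbound : ∀ w ∈ Metric.ball w₀ (d / 2), ‖F w‖ ≤ m * A := fun w hw => by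
    have h1 := hsub w hw
    have h2 := hmax' w (by rw [Metric.mem_closedBall, dist_eq_norm]; linarith)
    have h3 : (d / 2) ^ (2 / q) ≤ (1 - ‖w - z‖) ^ (2 / q) :=
      Real.rpow_le_rpow (by linarith) (by linarith) (by positivity)
    have h4 : ‖F w‖ * (d / 2) ^ (2 / q) ≤ m * d ^ (2 / q) :=
      (mul_le_mul_of_nonneg_left h3 (norm_nonneg _)).trans h2
    rw [Real.div_rpow hd0.le zero_le_two, ← hA, mul_div_assoc', div_le_iff₀ hA0] at h4
    have h5 : 0 < d ^ (2 / q) := by positivity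
    nlinarith
  have hmean := enorm_le_lintegral_ball hF w₀ (half_pos hd0)
  have hle : ∫⁻ w in Metric.ball w₀ (d / 2), ‖F w‖ₑ ≤ ENNReal.ofReal ((m * A) ^ (1 - q)) * I := by
    rw [hI, ← lintegral_const_mul' _ _ ENNReal.ofReal_ne_top]
    refine le_trans (setLIntegral_mono' Metric.isOpen_ball.measurableSet fun w hw => ?_)
      (lintegral_mono_set (s := Metric.ball w₀ (d / 2)) fun w hw => ?_)
    · rw [← ENNReal.ofReal_mul (by positivity), ← ofReal_norm]
      apply ENNReal.ofReal_le_ofReal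
      rcases (norm_nonneg (F w)).eq_or_lt with h0 | h0
      · rw [← h0]; positivity
      calc ‖F w‖ = ‖F w‖ ^ (1 - q) * ‖F w‖ ^ q := by
            rw [← Real.rpow_add h0, sub_add_cancel, Real.rpow_one]
        _ ≤ _ := by
            have := sub_nonneg.2 hq1
            gcongr
            exact hbound w hw
    · rw [Metric.mem_ball, dist_eq_norm]
      linarith [hsub w hw]
  have hreal := hmean.trans hle
  rw [← ofReal_norm, ← hm, ← ENNReal.ofReal_toReal hItop, ← ENNReal.ofReal_mul (by positivity),
    ← ENNReal.ofReal_mul (by positivity), ENNReal.ofReal_le_ofReal_iff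
      (mul_nonneg (by positivity) ENNReal.toReal_nonneg)] at hreal
  rw [← ENNReal.ofReal_toReal hItop, ← ENNReal.ofReal_mul (by positivity)]
  apply ENNReal.ofReal_le_ofReal
  have hpow : ‖F z‖ ^ q ≤ m ^ q * d ^ 2 := by
    refine (Real.rpow_le_rpow (norm_nonneg _) hz hq.le).trans_eq ?_
    rw [Real.mul_rpow hm0.le (by positivity), ← Real.rpow_mul hd0.le, div_mul_cancel₀ _ hq.ne',
      Real.rpow_two]
  refine hpow.trans ?_
  rw [Real.mul_rpow hm0.le hA0.le] at hreal
  -- The factor m^(1-q) coming from `hle` is cancelled, which is why m = 0 was treated apart.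
  have hmq : m = m ^ (1 - q) * m ^ q := by
    rw [← Real.rpow_add hm0, sub_add_cancel, Real.rpow_one]
  have hm1 : 0 < m ^ (1 - q) := by positivity
  have hfin : m ^ (1 - q) * (m ^ q * d ^ 2) ≤ m ^ (1 - q) * (4 * A ^ (1 - q) * I.toReal) := by
    calc m ^ (1 - q) * (m ^ q * d ^ 2) = 4 * ((d / 2) ^ 2 * m) := by
          conv_rhs => rw [hmq]
          ring
      _ ≤ 4 * (m ^ (1 - q) * A ^ (1 - q) * I.toReal) := by linarith
      _ = _ := by ring
  exact le_of_mul_le_mul_left hfin hm1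

/-- Local `L^q` control of an entire function, for every `q > 0`. -/
theorem exists_rpow_norm_le_lintegral_ball {q : ℝ} (hq : 0 < q) :
    ∃ C : ℝ, 0 < C ∧ ∀ F : ℂ → ℂ, Differentiable ℂ F → ∀ z : ℂ,
      ENNReal.ofReal (‖F z‖ ^ q) ≤
        ENNReal.ofReal C * ∫⁻ w in Metric.ball z 1, ENNReal.ofReal (‖F w‖ ^ q) := by
  obtain ⟨n, hn⟩ := exists_nat_ge q
  have hn0 : (0 : ℝ) < n := hq.trans_le hn
  -- |F|^q = |F^n|^(q/n) with F^n entire and q/n ≤ 1.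
  obtain ⟨C, hC, h⟩ := exists_rpow_norm_le_lintegral_ball_of_le_one (q := q / n) (by positivity)
    ((div_le_one hn0).2 hn)
  refine ⟨C, hC, fun F hF z => ?_⟩
  have key (w : ℂ) : ‖F w ^ n‖ ^ (q / n) = ‖F w‖ ^ q := by
    rw [norm_pow, ← Real.rpow_natCast, ← Real.rpow_mul (norm_nonneg _), mul_div_cancel₀ _ hn0.ne']
  simpa only [key] using h (fun w => F w ^ n) (hF.pow n) z

/-! ### Gaussian weights and local bounds -/

/-- The Gaussian-weighted modulus `|f(z)| e^{-α|z|²/2}`. -/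
noncomputable def gaussNorm (α : ℝ) (f : ℂ → ℂ) (z : ℂ) : ℝ :=
  ‖f z‖ * Real.exp (-(α * ‖z‖ ^ 2 / 2))

theorem gaussNorm_nonneg (α : ℝ) (f : ℂ → ℂ) (z : ℂ) : 0 ≤ gaussNorm α f z := by
  unfold gaussNorm; positivity

theorem continuous_gaussNorm (α : ℝ) {f : ℂ → ℂ} (hf : Continuous f) :
    Continuous (gaussNorm α f) := by
  unfold gaussNorm; fun_prop

theorem norm_eq_gaussNorm_mul (α : ℝ) (f : ℂ → ℂ) (z : ℂ) :
    ‖f z‖ = gaussNorm α f z * Real.exp (α * ‖z‖ ^ 2 / 2) := by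
  rw [gaussNorm, mul_assoc, ← Real.exp_add, neg_add_cancel, Real.exp_zero, mul_one]

theorem norm_mul_exp_eq_gaussNorm (α : ℝ) (f : ℂ → ℂ) (z : ℂ) :
    ‖f z * (Real.exp (-(α * ‖z‖ ^ 2 / 2)) : ℂ)‖ = gaussNorm α f z := by
  rw [norm_mul, Complex.norm_real, Real.norm_of_nonneg (Real.exp_nonneg _), gaussNorm]

/-- The density `(|f(z)| e^{-α|z|²/2})^q`. -/
noncomputable def gaussDensity (α q : ℝ) (f : ℂ → ℂ) (z : ℂ) : ℝ≥0∞ :=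
  ENNReal.ofReal (gaussNorm α f z ^ q)

theorem measurable_gaussDensity (α q : ℝ) {f : ℂ → ℂ} (hf : Continuous f) :
    Measurable (gaussDensity α q f) :=
  ((continuous_gaussNorm α hf).measurable.pow_const q).ennreal_ofReal

/-- The mass of `gaussDensity` on the disc of radius `2` around `z`. -/
noncomputable def localMass (α q : ℝ) (f : ℂ → ℂ) (z : ℂ) : ℝ≥0∞ :=
  ∫⁻ w in Metric.ball z 2, gaussDensity α q f w

theorem aestronglyMeasurable_mul_exp (α : ℝ) {f : ℂ → ℂ} (hf : Continuous f) :
    AEStronglyMeasurable (fun z : ℂ => f z * (Real.exp (-(α * ‖z‖ ^ 2 / 2)) : ℂ)) volume :=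
  Continuous.aestronglyMeasurable (by fun_prop)

theorem mem_weightedLp_iff_lintegral (α : ℝ) {p : ℝ≥0∞} (hp : p ≠ 0) (hp' : p ≠ ⊤) {f : ℂ → ℂ}
    (hf : Continuous f) :
    f ∈ weightedLp α p ↔ ∫⁻ z, gaussDensity α p.toReal f z < ⊤ := by
  have key : (∫⁻ z, ‖f z * (Real.exp (-(α * ‖z‖ ^ 2 / 2)) : ℂ)‖ₑ ^ p.toReal) =
      ∫⁻ z, gaussDensity α p.toReal f z := by
    refine lintegral_congr fun z => ?_
    rw [← ofReal_norm, norm_mul_exp_eq_gaussNorm,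
      ENNReal.ofReal_rpow_of_nonneg (gaussNorm_nonneg α f z) ENNReal.toReal_nonneg, gaussDensity]
  rw [← key, ← eLpNorm_lt_top_iff_lintegral_rpow_enorm_lt_top hp hp']
  exact ⟨fun h => h.2, fun h => ⟨aestronglyMeasurable_mul_exp α hf, h⟩⟩

theorem mem_weightedLp_top_iff (α : ℝ) {f : ℂ → ℂ} (hf : Continuous f) :
    f ∈ weightedLp α ⊤ ↔ ∃ M, ∀ z, gaussNorm α f z ≤ M := by
  constructor
  · intro h
    have h2 := h.eLpNorm_lt_top
    rw [eLpNorm_exponent_top] at h2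
    refine ⟨(eLpNormEssSup (fun z : ℂ => f z * (Real.exp (-(α * ‖z‖ ^ 2 / 2)) : ℂ))
      volume).toReal, ?_⟩
    set M := eLpNormEssSup (fun z : ℂ => f z * (Real.exp (-(α * ‖z‖ ^ 2 / 2)) : ℂ)) volume
    have h3 : ∀ᵐ z : ℂ, gaussNorm α f z ≤ M.toReal := by
      filter_upwards [enorm_ae_le_eLpNormEssSup
        (fun z : ℂ => f z * (Real.exp (-(α * ‖z‖ ^ 2 / 2)) : ℂ)) volume] with z hz
      rw [← norm_mul_exp_eq_gaussNorm, ← toReal_enorm]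
      exact ENNReal.toReal_mono h2.ne hz
    -- By continuity the exceptional null set is open, hence empty.
    have hopen : IsOpen {z | ¬ gaussNorm α f z ≤ M.toReal} := by
      simpa only [not_le] using isOpen_lt continuous_const (continuous_gaussNorm α hf)
    have hempty := (hopen.measure_eq_zero_iff volume).1 (ae_iff.1 h3)
    intro z
    by_contra hz
    exact Set.notMem_empty z (hempty ▸ hz)
  · rintro ⟨M, hM⟩
    refine memLp_top_of_bound (aestronglyMeasurable_mul_exp α hf) M (.of_forall fun z => ?_)
    rw [norm_mul_exp_eq_gaussNorm]
    exact hM z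

/-- The weight is not the modulus of a holomorphic function, but multiplying f by exp(-αζw̄ +
α|w|²/2) gives an entire function of modulus N f(ζ) e^{α|ζ-w|²/2}. It equals N f(w) at ζ = w and
exceeds N f by at most e^{α/2} on the unit disc about w, so the unweighted estimate applies. -/
theorem exists_gaussDensity_le_localMass {α q : ℝ} (hα : 0 < α) (hq : 0 < q) :
    ∃ C : ℝ, 0 < C ∧ ∀ f : ℂ → ℂ, Differentiable ℂ f → ∀ z : ℂ, ∀ w ∈ Metric.closedBall z 1,
      gaussDensity α q f w ≤ ENNReal.ofReal C * localMass α q f z := by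
  obtain ⟨C, hC, h⟩ := exists_rpow_norm_le_lintegral_ball hq
  refine ⟨C * Real.exp (α / 2) ^ q, by positivity, fun f hf z w hw => ?_⟩
  set F : ℂ → ℂ := fun ζ =>
    f ζ * Complex.exp (-(α * ζ * (starRingEnd ℂ) w) + α * ‖w‖ ^ 2 / 2) with hF
  have hFd : Differentiable ℂ F := by fun_prop
  have hnorm (ζ : ℂ) : ‖F ζ‖ = gaussNorm α f ζ * Real.exp (α * ‖ζ - w‖ ^ 2 / 2) := by
    rw [hF, norm_mul, Complex.norm_exp, gaussNorm, mul_assoc ‖f ζ‖ (Real.exp _), ← Real.exp_add]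
    congr 2
    have h1 := Complex.normSq_sub ζ w
    simp only [← Complex.sq_norm] at h1
    have h2 : (-((α : ℂ) * ζ * (starRingEnd ℂ) w) + α * ‖w‖ ^ 2 / 2).re =
        -(α * (ζ * (starRingEnd ℂ) w).re) + α * ‖w‖ ^ 2 / 2 := by
      rw [show (-((α : ℂ) * ζ * (starRingEnd ℂ) w) + α * ‖w‖ ^ 2 / 2) =
        -((α : ℂ) * (ζ * (starRingEnd ℂ) w)) + ((α * ‖w‖ ^ 2 / 2 : ℝ) : ℂ) by push_cast; ring]
      simp only [Complex.add_re, Complex.neg_re, Complex.re_ofReal_mul, Complex.ofReal_re]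
    rw [h2, h1]
    ring
  have hw0 : ‖F w‖ = gaussNorm α f w := by simp [hnorm]
  have h1 := h F hFd w
  rw [hw0] at h1
  refine h1.trans ?_
  rw [ENNReal.ofReal_mul hC.le, mul_assoc]
  gcongr
  rw [localMass, ← lintegral_const_mul' _ _ ENNReal.ofReal_ne_top]
  refine le_trans (setLIntegral_mono' Metric.isOpen_ball.measurableSet fun ζ hζ => ?_)
    (lintegral_mono_set (s := Metric.ball w 1) (Metric.ball_subset_ball' ?_))
  · have hg := gaussNorm_nonneg α f ζ
    rw [gaussDensity, ← ENNReal.ofReal_mul (by positivity), ← Real.mul_rpow (by positivity) hg,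
      mul_comm (Real.exp _), hnorm]
    rw [Metric.mem_ball, dist_eq_norm] at hζ
    gcongr
    have : ‖ζ - w‖ ^ 2 ≤ 1 := pow_le_one₀ (norm_nonneg _) hζ.le
    nlinarith
  · have := Metric.mem_closedBall.1 hw
    linarith

/-- A bound for `gaussNorm` on unit discs that is controlled by `localMass`. -/
theorem exists_gaussNorm_bound {α q : ℝ} (hα : 0 < α) (hq : 0 < q) :
    ∃ C : ℝ, 0 < C ∧ ∀ f : ℂ → ℂ, Differentiable ℂ f → ∀ z : ℂ, ∃ S : ℝ, 0 ≤ S ∧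
      (∀ w ∈ Metric.closedBall z 1, gaussNorm α f w ≤ S) ∧
      ENNReal.ofReal (S ^ q) ≤ ENNReal.ofReal C * localMass α q f z := by
  obtain ⟨C, hC, h⟩ := exists_gaussDensity_le_localMass hα hq
  refine ⟨C, hC, fun f hf z => ?_⟩
  obtain ⟨w, hw, hmax⟩ := (isCompact_closedBall z 1).exists_isMaxOn
    ⟨z, Metric.mem_closedBall_self zero_le_one⟩
    (continuous_gaussNorm α hf.continuous).continuousOn
  exact ⟨gaussNorm α f w, gaussNorm_nonneg α f w, fun v hv => hmax hv, h f hf z w hw⟩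

/-! ### Integrals over discs and pointwise bounds -/

/-- Tonelli, with the symmetry w ∈ B(z, r) ⇔ z ∈ B(w, r). -/
theorem setLIntegral_lintegral_ball_le {u : ℂ → ℝ≥0∞} (hu : Measurable u) {s t : Set ℂ}
    (ht : MeasurableSet t) {r : ℝ} (hst : ∀ z ∈ s, Metric.ball z r ⊆ t) (hs : MeasurableSet s) :
    ∫⁻ z in s, ∫⁻ w in Metric.ball z r, u w ≤
      volume (Metric.ball (0 : ℂ) r) * ∫⁻ w in t, u w := by
  have hball (w : ℂ) : MeasurableSet (Metric.ball w r) := Metric.isOpen_ball.measurableSet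
  have hmeas : Measurable fun x : ℂ × ℂ => (Metric.ball x.1 r).indicator u x.2 := by
    have : (fun x : ℂ × ℂ => (Metric.ball x.1 r).indicator u x.2) =
        {x : ℂ × ℂ | dist x.2 x.1 < r}.indicator fun x => u x.2 := by
      ext x; simp [Set.indicator]
    rw [this]
    exact (hu.comp measurable_snd).indicator
      (isOpen_lt (by fun_prop) continuous_const).measurableSet
  calc ∫⁻ z in s, ∫⁻ w in Metric.ball z r, u w
      ≤ ∫⁻ z in s, ∫⁻ w in t, (Metric.ball z r).indicator u w := by
        refine setLIntegral_mono' hs fun z hz => ?_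
        rw [lintegral_indicator (hball z), Measure.restrict_restrict (hball z),
          Set.inter_eq_left.2 (hst z hz)]
    _ ≤ ∫⁻ z, ∫⁻ w in t, (Metric.ball z r).indicator u w := setLIntegral_le_lintegral _ _
    _ = ∫⁻ w in t, ∫⁻ z, (Metric.ball z r).indicator u w :=
        lintegral_lintegral_swap hmeas.aemeasurable
    _ = ∫⁻ w in t, volume (Metric.ball (0 : ℂ) r) * u w := by
        refine setLIntegral_congr_fun ht fun w _ => ?_
        have : (fun z => (Metric.ball z r).indicator u w) =
            (Metric.ball w r).indicator fun _ => u w := by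
          ext z; simp [Set.indicator, dist_comm]
        simp only [this]
        rw [lintegral_indicator_const (hball w), mul_comm, Complex.volume_ball,
          Complex.volume_ball]
    _ = _ := by rw [lintegral_const_mul _ hu]

theorem lintegral_localMass_le (α q : ℝ) {f : ℂ → ℂ} (hf : Continuous f) :
    ∫⁻ z, localMass α q f z ≤
      volume (Metric.ball (0 : ℂ) 2) * ∫⁻ w, gaussDensity α q f w := by
  simpa [localMass] using setLIntegral_lintegral_ball_le (measurable_gaussDensity α q hf)
    MeasurableSet.univ (r := 2) (fun z _ => Set.subset_univ _) MeasurableSet.univ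

theorem setLIntegral_closedBall_localMass_le (α q : ℝ) {f : ℂ → ℂ} (hf : Continuous f) (R : ℝ) :
    ∫⁻ z in Metric.closedBall 0 R, localMass α q f z ≤
      volume (Metric.ball (0 : ℂ) 2) * ∫⁻ w in Metric.closedBall 0 (R + 2), gaussDensity α q f w :=
  setLIntegral_lintegral_ball_le (measurable_gaussDensity α q hf)
    Metric.isClosed_closedBall.measurableSet
    (fun z hz => (Metric.ball_subset_closedBall).trans (Metric.closedBall_subset_closedBall' (by
      have := Metric.mem_closedBall.1 hz
      linarith))) Metric.isClosed_closedBall.measurableSet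

theorem exists_gaussNorm_le_on_closedBall (α : ℝ) {f : ℂ → ℂ} (hf : Continuous f) (R : ℝ) :
    ∃ M : ℝ, 0 ≤ M ∧ ∀ z, ‖z‖ ≤ R → gaussNorm α f z ≤ M := by
  obtain ⟨M, hM⟩ := (isCompact_closedBall (0 : ℂ) R).exists_bound_of_continuousOn
    (continuous_gaussNorm α hf).continuousOn
  refine ⟨max M 0, le_max_right _ _, fun z hz => ?_⟩
  exact ((le_abs_self _).trans (hM z (by simpa using hz))).trans (le_max_left _ _)

theorem setLIntegral_gaussDensity_le (α : ℝ) {q M : ℝ} (hq : 0 < q) {f : ℂ → ℂ} {s : Set ℂ}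
    (hs : MeasurableSet s) (hM : ∀ z ∈ s, gaussNorm α f z ≤ M) :
    ∫⁻ z in s, gaussDensity α q f z ≤ ENNReal.ofReal (M ^ q) * volume s := by
  rw [← setLIntegral_const]
  refine setLIntegral_mono' hs fun z hz => ENNReal.ofReal_le_ofReal ?_
  exact Real.rpow_le_rpow (gaussNorm_nonneg α f z) (hM z hz) hq.le

theorem setLIntegral_closedBall_gaussDensity_lt_top (α : ℝ) {q : ℝ} (hq : 0 < q) {f : ℂ → ℂ}
    (hf : Continuous f) (R : ℝ) :
    ∫⁻ z in Metric.closedBall 0 R, gaussDensity α q f z < ⊤ := by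
  obtain ⟨M, -, hM⟩ := exists_gaussNorm_le_on_closedBall α hf R
  refine (setLIntegral_gaussDensity_le α hq Metric.isClosed_closedBall.measurableSet
    (fun z hz => hM z (by simpa using hz))).trans_lt ?_
  exact ENNReal.mul_lt_top ENNReal.ofReal_lt_top measure_closedBall_lt_top

/-- Functions of a Fock space have bounded Gaussian-weighted modulus. -/
theorem exists_gaussNorm_le_of_mem_weightedLp {α : ℝ} (hα : 0 < α) {p : ℝ≥0∞} (hp : 0 < p)
    {f : ℂ → ℂ} (hf : Differentiable ℂ f) (h : f ∈ weightedLp α p) :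
    ∃ M, ∀ z, gaussNorm α f z ≤ M := by
  rcases eq_or_ne p ⊤ with rfl | hp'
  · exact (mem_weightedLp_top_iff α hf.continuous).1 h
  have hq := ENNReal.toReal_pos hp.ne' hp'
  rw [mem_weightedLp_iff_lintegral α hp.ne' hp' hf.continuous] at h
  obtain ⟨C, hC, hloc⟩ := exists_gaussDensity_le_localMass hα hq
  set J := ∫⁻ z, gaussDensity α p.toReal f z
  refine ⟨(C * J.toReal) ^ (p.toReal)⁻¹, fun z => ?_⟩
  have h1 := (hloc f hf z z (Metric.mem_closedBall_self zero_le_one)).trans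
    (mul_le_mul_right (setLIntegral_le_lintegral _ _) _)
  change gaussDensity α p.toReal f z ≤ ENNReal.ofReal C * J at h1
  rw [gaussDensity, ← ENNReal.ofReal_toReal h.ne, ← ENNReal.ofReal_mul hC.le,
    ENNReal.ofReal_le_ofReal_iff (mul_nonneg hC.le ENNReal.toReal_nonneg)] at h1
  exact (Real.le_rpow_inv_iff_of_pos (gaussNorm_nonneg α f z)
    (mul_nonneg hC.le ENNReal.toReal_nonneg) hq).2 h1

/-! ### From f to f'/z + c f/z² -/

/-- Cauchy's estimate on the circle of radius 1/|z|: there |w|² ≤ |z|² + 3, so the weight changes by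
at most e^{3α/2}, and the lost factor |z| cancels against the division by z. -/
theorem gaussNorm_div_id_add_le {α : ℝ} (hα : 0 < α) {f : ℂ → ℂ} (hf : Differentiable ℂ f)
    (c : ℂ) {z : ℂ} (hz : 1 ≤ ‖z‖) {S : ℝ}
    (hS : ∀ w ∈ Metric.closedBall z 1, gaussNorm α f w ≤ S) :
    gaussNorm α (fun z => deriv f z / z + c * (f z / z ^ 2)) z ≤
      (Real.exp (3 * α / 2) + ‖c‖) * S := by
  have hz0 : 0 < ‖z‖ := by linarith
  have hSz := hS z (Metric.mem_closedBall_self zero_le_one)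
  have hS0 : 0 ≤ S := (gaussNorm_nonneg α f z).trans hSz
  set E := Real.exp (α * ‖z‖ ^ 2 / 2) with hE
  have hE0 : 0 < E := Real.exp_pos _
  have hder : ‖deriv f z‖ ≤ S * (E * Real.exp (3 * α / 2)) / ‖z‖⁻¹ := by
    refine Complex.norm_deriv_le_of_forall_mem_sphere_norm_le (inv_pos.2 hz0) hf.diffContOnCl
      fun w hw => ?_
    rw [mem_sphere_iff_norm] at hw
    have hinv : ‖z‖⁻¹ ≤ 1 := inv_le_one_of_one_le₀ hz
    rw [norm_eq_gaussNorm_mul α f w, hE, ← Real.exp_add]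
    have hw1 : ‖w‖ ≤ ‖z‖ + ‖z‖⁻¹ := by
      have := norm_add_le z (w - z)
      rw [add_sub_cancel, hw] at this
      exact this
    have hw2 : ‖w‖ ^ 2 ≤ ‖z‖ ^ 2 + 3 := by
      have h1 : ‖w‖ ^ 2 ≤ (‖z‖ + ‖z‖⁻¹) ^ 2 := by gcongr
      have h2 : ‖z‖ * ‖z‖⁻¹ = 1 := mul_inv_cancel₀ hz0.ne'
      have h3 : ‖z‖⁻¹ ^ 2 ≤ 1 := pow_le_one₀ (by positivity) hinv
      nlinarith
    gcongr
    · exact hS w (by rw [mem_closedBall_iff_norm, hw]; exact hinv)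
    · nlinarith
  rw [div_inv_eq_mul] at hder
  have hEn : Real.exp (-(α * ‖z‖ ^ 2 / 2)) = E⁻¹ := by rw [hE, Real.exp_neg]
  have h1 : ‖deriv f z / z‖ ≤ S * (E * Real.exp (3 * α / 2)) := by
    rwa [norm_div, div_le_iff₀ hz0]
  have h2 : ‖c * (f z / z ^ 2)‖ ≤ ‖c‖ * (S * E) := by
    rw [norm_mul, norm_div, norm_pow, norm_eq_gaussNorm_mul α f z]
    gcongr
    refine (div_le_self (mul_nonneg (gaussNorm_nonneg _ _ _) hE0.le) (one_le_pow₀ hz)).trans ?_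
    gcongr
  rw [gaussNorm, hEn, ← div_eq_mul_inv, div_le_iff₀ hE0]
  refine (norm_add_le _ _).trans ((add_le_add h1 h2).trans_eq ?_)
  ring

/-- Membership in `weightedLp` passes from `f` to `g` if, far from the origin, `gaussNorm α g` is
bounded by a multiple of the local suprema of `gaussNorm α f`. -/
theorem mem_weightedLp_of_local_bound {α : ℝ} (hα : 0 < α) {p : ℝ≥0∞} (hp : 0 < p) {f g : ℂ → ℂ}
    (hf : Differentiable ℂ f) (hg : Continuous g) {K R : ℝ} (hK : 0 ≤ K)
    (h : ∀ z : ℂ, R < ‖z‖ → ∀ S : ℝ, 0 ≤ S → (∀ w ∈ Metric.closedBall z 1, gaussNorm α f w ≤ S) →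
      gaussNorm α g z ≤ K * S) (hfp : f ∈ weightedLp α p) : g ∈ weightedLp α p := by
  rcases eq_or_ne p ⊤ with rfl | hp'
  · rw [mem_weightedLp_top_iff α hg]
    obtain ⟨M, hM⟩ := (mem_weightedLp_top_iff α hf.continuous).1 hfp
    obtain ⟨N, -, hN⟩ := exists_gaussNorm_le_on_closedBall α hg R
    refine ⟨max N (K * M), fun z => ?_⟩
    rcases le_or_gt ‖z‖ R with hz | hz
    · exact (hN z hz).trans (le_max_left _ _)
    · exact (h z hz M ((gaussNorm_nonneg α f z).trans (hM z)) fun w _ => hM w).trans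
        (le_max_right _ _)
  have hq := ENNReal.toReal_pos hp.ne' hp'
  rw [mem_weightedLp_iff_lintegral α hp.ne' hp' hf.continuous] at hfp
  rw [mem_weightedLp_iff_lintegral α hp.ne' hp' hg]
  set q := p.toReal
  obtain ⟨C, hC, hloc⟩ := exists_gaussNorm_bound hα hq
  have hB : MeasurableSet (Metric.closedBall (0 : ℂ) R) :=
    Metric.isClosed_closedBall.measurableSet
  rw [← lintegral_add_compl _ hB]
  refine ENNReal.add_lt_top.2 ⟨setLIntegral_closedBall_gaussDensity_lt_top α hq hg R, ?_⟩
  have hbound : ∫⁻ z in (Metric.closedBall (0 : ℂ) R)ᶜ, gaussDensity α q g z ≤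
      ∫⁻ z in (Metric.closedBall (0 : ℂ) R)ᶜ,
        ENNReal.ofReal (K ^ q) * ENNReal.ofReal C * localMass α q f z := by
    refine setLIntegral_mono' hB.compl fun z hz => ?_
    have hz' : R < ‖z‖ := by simpa using hz
    obtain ⟨S, hS0, hS, hSC⟩ := hloc f hf z
    calc gaussDensity α q g z ≤ ENNReal.ofReal ((K * S) ^ q) :=
          ENNReal.ofReal_le_ofReal (Real.rpow_le_rpow (gaussNorm_nonneg α g z)
            (h z hz' S hS0 hS) hq.le)
      _ = ENNReal.ofReal (K ^ q) * ENNReal.ofReal (S ^ q) := by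
          rw [Real.mul_rpow hK hS0, ENNReal.ofReal_mul (by positivity)]
      _ ≤ _ := by
          rw [mul_assoc]
          gcongr
  refine hbound.trans_lt ((setLIntegral_le_lintegral _ _).trans_lt ?_)
  rw [lintegral_const_mul' _ _ (ENNReal.mul_ne_top ENNReal.ofReal_ne_top ENNReal.ofReal_ne_top)]
  refine ENNReal.mul_lt_top (ENNReal.mul_lt_top ENNReal.ofReal_lt_top ENNReal.ofReal_lt_top) ?_
  exact (lintegral_localMass_le α q hf.continuous).trans_lt
    (ENNReal.mul_lt_top measure_ball_lt_top hfp)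

/-! ### From f'/z + c f/z² back to f -/

/-- A function satisfying `f'(z)/z + c f(z)/z² = g(z)` is controlled by nearby values of `g` and,
with an arbitrarily small constant, by its own values at nearby points of smaller modulus. -/
theorem exists_gaussNorm_le_of_eq_div_id_add {α : ℝ} (hα : 0 < α) {f g : ℂ → ℂ}
    (hf : Differentiable ℂ f) {c : ℂ}
    (hg : ∀ z : ℂ, z ≠ 0 → g z = deriv f z / z + c * (f z / z ^ 2)) {ε : ℝ} (hε : 0 < ε) :
    ∃ K R : ℝ, 0 < K ∧ 0 < R ∧ ∀ z : ℂ, R < ‖z‖ → ∀ Sf Sg : ℝ,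
      (∀ w ∈ Metric.closedBall z 1, ‖w‖ ≤ ‖z‖ → gaussNorm α f w ≤ Sf) →
      (∀ w ∈ Metric.closedBall z 1, ‖w‖ ≤ ‖z‖ → gaussNorm α g w ≤ Sg) →
      gaussNorm α f z ≤ ε * Sf + K * Sg := by
  obtain ⟨L, hL0, hL⟩ : ∃ L : ℝ, 0 < L ∧ Real.exp (-(α * L / 2)) ≤ ε / 2 := by
    refine ⟨max 1 (-(2 / α * Real.log (ε / 2))), by positivity, ?_⟩
    rw [← Real.le_log_iff_exp_le (by positivity)]
    have h1 : α / 2 * (-(2 / α * Real.log (ε / 2))) ≤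
        α / 2 * max 1 (-(2 / α * Real.log (ε / 2))) := by
      gcongr
      exact le_max_right _ _
    have h2 : α / 2 * (-(2 / α * Real.log (ε / 2))) = -Real.log (ε / 2) := by field_simp
    linarith
  -- The terms 2 and 2L of R keep the step L/|z| at most 1/2 and the points used away from 0; the
  -- last makes the c-term at most (ε/2) `Sf`.
  refine ⟨L, 2 + 2 * L + 4 * ‖c‖ * L / ε, hL0, by positivity, fun z hz Sf Sg hSf hSg => ?_⟩
  have hcL : 0 ≤ 4 * ‖c‖ * L / ε := by positivity
  have hz2 : 2 ≤ ‖z‖ := by linarith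
  have hz2L : 2 * L ≤ ‖z‖ := by linarith
  have hz0 : 0 < ‖z‖ := by linarith
  have hzc : 4 * ‖c‖ * L ≤ ‖z‖ * ε := by rw [← div_le_iff₀ hε]; linarith
  set h := L / ‖z‖ with hh
  have hh0 : 0 < h := by positivity
  have hhz : h * ‖z‖ = L := by rw [hh]; field_simp
  have hh1 : h ≤ 1 / 2 := by rw [hh, div_le_iff₀ hz0]; linarith
  have hzmem : z ∈ Metric.closedBall z 1 := Metric.mem_closedBall_self zero_le_one
  have hSf0 : 0 ≤ Sf := (gaussNorm_nonneg α f z).trans (hSf z hzmem le_rfl)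
  have hSg0 : 0 ≤ Sg := (gaussNorm_nonneg α g z).trans (hSg z hzmem le_rfl)
  set E := Real.exp (α * ‖z‖ ^ 2 / 2) with hE
  have hE0 : 0 < E := Real.exp_pos _
  -- A convex set containing the radial segment from z₀ to z; on it |w| ≤ |z|, so the Gaussian
  -- growth is at most E.
  set s := Metric.closedBall z h ∩ Metric.closedBall 0 ‖z‖ with hs
  have hs1 : ∀ w ∈ s, w ∈ Metric.closedBall z 1 ∧ ‖w‖ ≤ ‖z‖ := fun w hw =>
    ⟨Metric.closedBall_subset_closedBall (by linarith) hw.1, by simpa using hw.2⟩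
  have hsconv : Convex ℝ s := (convex_closedBall z h).inter (convex_closedBall 0 ‖z‖)
  have hexp (w : ℂ) (hw : ‖w‖ ≤ ‖z‖) : Real.exp (α * ‖w‖ ^ 2 / 2) ≤ E := by
    rw [hE]; gcongr
  have hder : ∀ w ∈ s, ‖deriv f w‖ ≤ ‖z‖ * (Sg * E) + 2 * ‖c‖ / ‖z‖ * (Sf * E) := fun w hw => by
    obtain ⟨hw1, hwz⟩ := hs1 w hw
    have hwl : ‖z‖ / 2 ≤ ‖w‖ := by
      have h1 := norm_sub_norm_le z w
      have h2 := hw.1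
      rw [mem_closedBall_iff_norm'] at h2
      linarith
    have hw0 : 0 < ‖w‖ := by linarith
    have hwne : w ≠ 0 := norm_pos_iff.1 hw0
    have hdw : deriv f w = w * g w - c / w * f w := by
      rw [hg w hwne]
      field_simp
      ring
    have hgw : ‖g w‖ ≤ Sg * E := by
      rw [norm_eq_gaussNorm_mul α g w]
      exact mul_le_mul (hSg w hw1 hwz) (hexp w hwz) (Real.exp_nonneg _) hSg0
    have hfw : ‖f w‖ ≤ Sf * E := by
      rw [norm_eq_gaussNorm_mul α f w]
      exact mul_le_mul (hSf w hw1 hwz) (hexp w hwz) (Real.exp_nonneg _) hSf0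
    have hcw : ‖c‖ / ‖w‖ ≤ 2 * ‖c‖ / ‖z‖ := by
      rw [div_le_div_iff₀ hw0 hz0]
      nlinarith [norm_nonneg c]
    rw [hdw]
    refine (norm_sub_le _ _).trans ?_
    rw [norm_mul, norm_mul, norm_div]
    gcongr
  set z₀ : ℂ := ((1 - h / ‖z‖ : ℝ) : ℂ) * z with hz₀
  have hhz1 : h / ‖z‖ ≤ 1 := by rw [div_le_iff₀ hz0]; linarith
  have hz₀n : ‖z₀‖ = ‖z‖ - h := by
    rw [hz₀, norm_mul, Complex.norm_real, Real.norm_of_nonneg (by linarith)]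
    field_simp
  have hz₀d : ‖z - z₀‖ = h := by
    have : z - z₀ = ((h / ‖z‖ : ℝ) : ℂ) * z := by rw [hz₀]; push_cast; ring
    rw [this, norm_mul, Complex.norm_real, Real.norm_of_nonneg (by positivity)]
    field_simp
  have hz₀s : z₀ ∈ s :=
    ⟨by rw [mem_closedBall_iff_norm', hz₀d], by rw [mem_closedBall_zero_iff, hz₀n]; linarith⟩
  have hzs : z ∈ s := ⟨Metric.mem_closedBall_self hh0.le, by simp⟩
  have hmvt := hsconv.norm_image_sub_le_of_norm_deriv_le
    (fun w _ => hf.differentiableAt) hder hz₀s hzs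
  rw [hz₀d] at hmvt
  have hf₀ : ‖f z₀‖ ≤ Sf * (ε / 2 * E) := by
    rw [norm_eq_gaussNorm_mul α f z₀]
    refine mul_le_mul (hSf z₀ (hs1 z₀ hz₀s).1 (hs1 z₀ hz₀s).2) ?_ (Real.exp_nonneg _) hSf0
    calc Real.exp (α * ‖z₀‖ ^ 2 / 2) ≤ Real.exp (-(α * L / 2)) * E := by
          rw [hE, ← Real.exp_add, Real.exp_le_exp, hz₀n]
          -- Since h‖z‖ = L, the square is ‖z‖² - 2L + h², and h² ≤ h‖z‖ = L.
          have : (‖z‖ - h) ^ 2 ≤ ‖z‖ ^ 2 - L := by nlinarith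
          nlinarith
      _ ≤ _ := by gcongr
  have hsum : ‖f z‖ ≤ (ε * Sf + L * Sg) * E := by
    have h1 : ‖f z‖ ≤ ‖f z₀‖ + ‖f z - f z₀‖ := by
      simpa using norm_add_le (f z₀) (f z - f z₀)
    have h2 : (‖z‖ * (Sg * E) + 2 * ‖c‖ / ‖z‖ * (Sf * E)) * h =
        L * (Sg * E) + 2 * ‖c‖ / ‖z‖ * h * (Sf * E) := by
      rw [← hhz]; ring
    have h3 : 2 * ‖c‖ / ‖z‖ * h ≤ ε / 2 := by
      rw [hh, div_mul_div_comm, div_le_iff₀ (by positivity)]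
      have : ‖z‖ * ε * 1 ≤ ‖z‖ * ε * ‖z‖ := by gcongr; linarith
      nlinarith
    have h4 : 2 * ‖c‖ / ‖z‖ * h * (Sf * E) ≤ ε / 2 * (Sf * E) := by gcongr
    rw [h2] at hmvt
    nlinarith
  rw [gaussNorm, Real.exp_neg, ← hE, ← div_eq_mul_inv, div_le_iff₀ hE0]
  exact hsum

/-- At a maximum w of N f over the disc of radius |z|, the previous estimate with ε = 1/2 only
involves points of modulus at most |w|. Hence the maximum itself serves as `Sf`, and half of it can
be absorbed. -/
theorem exists_gaussNorm_le_of_eq_div_id_add_of_le {α : ℝ} (hα : 0 < α) {f g : ℂ → ℂ}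
    (hf : Differentiable ℂ f) {c : ℂ}
    (hg : ∀ z : ℂ, z ≠ 0 → g z = deriv f z / z + c * (f z / z ^ 2)) {G : ℝ}
    (hG : ∀ z, gaussNorm α g z ≤ G) : ∃ M, ∀ z, gaussNorm α f z ≤ M := by
  obtain ⟨K, R, hK, -, h⟩ := exists_gaussNorm_le_of_eq_div_id_add hα hf hg one_half_pos
  obtain ⟨N, hN0, hN⟩ := exists_gaussNorm_le_on_closedBall α hf.continuous R
  refine ⟨max N (2 * (K * G)), fun z => ?_⟩
  obtain ⟨w, hw, hmax⟩ := (isCompact_closedBall (0 : ℂ) ‖z‖).exists_isMaxOn ⟨z, by simp⟩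
    (continuous_gaussNorm α hf.continuous).continuousOn
  have hmax' : ∀ v : ℂ, ‖v‖ ≤ ‖z‖ → gaussNorm α f v ≤ gaussNorm α f w :=
    fun v hv => hmax (by simpa using hv)
  refine (hmax' z le_rfl).trans ?_
  rcases le_or_gt ‖w‖ R with hwR | hwR
  · exact (hN w hwR).trans (le_max_left _ _)
  · have hwz : ‖w‖ ≤ ‖z‖ := by simpa using hw
    have := h w hwR (gaussNorm α f w) G (fun v _ hv => hmax' v (hv.trans hwz)) (fun v _ _ => hG v)
    exact le_trans (by linarith) (le_max_right _ _)

/-- The sequence (x_m - 2a)/2^m is nondecreasing and bounded above by D(m+1)²/2^m → 0, hence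
nonpositive. -/
theorem le_two_mul_of_le_add_half_succ {x : ℕ → ℝ} {a D : ℝ} (ha : 0 ≤ a)
    (hx : ∀ n, x n ≤ a + x (n + 1) / 2) (hD : ∀ n : ℕ, x n ≤ D * (n + 1 : ℝ) ^ 2) (n : ℕ) :
    x n ≤ 2 * a := by
  set b : ℕ → ℝ := fun m => (x m - 2 * a) / 2 ^ m with hb
  have hmono : Monotone b := monotone_nat_of_le_succ fun m => by
    simp only [hb]
    rw [div_le_div_iff₀ (by positivity) (by positivity), pow_succ]
    have : (0 : ℝ) < 2 ^ m := by positivity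
    nlinarith [hx m]
  have hlim : Filter.Tendsto (fun m : ℕ => 2 * D * (((m + 1 : ℕ) : ℝ) ^ 2 / 2 ^ (m + 1)))
      Filter.atTop (nhds (2 * D * 0)) :=
    (((tendsto_pow_const_div_const_pow_of_one_lt 2 one_lt_two).comp
      (Filter.tendsto_add_atTop_nat 1))).const_mul _
  have hle : b n ≤ 2 * D * 0 := by
    refine ge_of_tendsto hlim (Filter.eventually_atTop.2 ⟨n, fun m hm => (hmono hm).trans ?_⟩)
    have h1 : 2 * D * (((m + 1 : ℕ) : ℝ) ^ 2 / 2 ^ (m + 1)) = D * (m + 1 : ℝ) ^ 2 / 2 ^ m := by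
      push_cast; rw [pow_succ (2 : ℝ) m]; field_simp
    rw [h1]
    simp only [hb]
    gcongr
    linarith [hD m]
  have h2 : (0 : ℝ) < 2 ^ n := by positivity
  simp only [hb, mul_zero] at hle
  rw [div_le_iff₀ h2] at hle
  linarith

theorem add_rpow_le_two_rpow_mul {a b q : ℝ} (ha : 0 ≤ a) (hb : 0 ≤ b) (hq : 0 ≤ q) :
    (a + b) ^ q ≤ 2 ^ q * (a ^ q + b ^ q) := by
  have hm : 0 ≤ max a b := le_max_of_le_left ha
  calc (a + b) ^ q ≤ (2 * max a b) ^ q := by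
        gcongr
        linarith [le_max_left a b, le_max_right a b]
    _ = 2 ^ q * max a b ^ q := Real.mul_rpow zero_le_two hm
    _ ≤ _ := by
        have h1 : 0 ≤ a ^ q := by positivity
        have h2 : 0 ≤ b ^ q := by positivity
        gcongr
        rcases max_cases a b with h | h <;> rw [h.1] <;> linarith

theorem measurable_localMass (α q : ℝ) {f : ℂ → ℂ} (hf : Continuous f) :
    Measurable (localMass α q f) := by
  have hmeas : Measurable ({x : ℂ × ℂ | dist x.2 x.1 < 2}.indicator
      fun x => gaussDensity α q f x.2) :=
    ((measurable_gaussDensity α q hf).comp measurable_snd).indicator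
      (isOpen_lt (by fun_prop) continuous_const).measurableSet
  have : localMass α q f = fun z => ∫⁻ w, ({x : ℂ × ℂ | dist x.2 x.1 < 2}.indicator
      fun x => gaussDensity α q f x.2) (z, w) := by
    ext z
    rw [localMass, ← lintegral_indicator Metric.isOpen_ball.measurableSet]
    rfl
  rw [this]
  exact hmeas.lintegral_prod_right'

theorem exists_gaussDensity_le_add_of_eq_div_id_add {α q : ℝ} (hα : 0 < α) (hq : 0 < q)
    {f g : ℂ → ℂ} (hf : Differentiable ℂ f) (hgd : Differentiable ℂ g) {c : ℂ}
    (hg : ∀ z : ℂ, z ≠ 0 → g z = deriv f z / z + c * (f z / z ^ 2)) {δ : ℝ} (hδ : 0 < δ) :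
    ∃ B R : ℝ, 0 < B ∧ 0 < R ∧ ∀ z : ℂ, R < ‖z‖ → gaussDensity α q f z ≤
      ENNReal.ofReal δ * localMass α q f z + ENNReal.ofReal B * localMass α q g z := by
  obtain ⟨C, hC, hloc⟩ := exists_gaussNorm_bound hα hq
  -- Solves 2^q ε^q C = δ, where 2^q comes from splitting the q-th power of a sum and C from the
  -- local bound.
  set ε : ℝ := (δ / (2 ^ q * C)) ^ q⁻¹ with hε
  have hε0 : 0 < ε := by positivity
  have hεq : 2 ^ q * (ε ^ q * C) = δ := by
    rw [hε, Real.rpow_inv_rpow (by positivity) hq.ne']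
    field_simp
  obtain ⟨K, R, hK, hR, h⟩ := exists_gaussNorm_le_of_eq_div_id_add hα hf hg hε0
  refine ⟨2 ^ q * (K ^ q * C), R, by positivity, hR, fun z hz => ?_⟩
  obtain ⟨Sf, hSf0, hSf, hSfC⟩ := hloc f hf z
  obtain ⟨Sg, hSg0, hSg, hSgC⟩ := hloc g hgd z
  have h1 := h z hz Sf Sg (fun w hw _ => hSf w hw) (fun w hw _ => hSg w hw)
  have h2 : gaussNorm α f z ^ q ≤ 2 ^ q * ε ^ q * Sf ^ q + 2 ^ q * K ^ q * Sg ^ q := by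
    refine (Real.rpow_le_rpow (gaussNorm_nonneg α f z) h1 hq.le).trans
      ((add_rpow_le_two_rpow_mul (by positivity) (by positivity) hq.le).trans_eq ?_)
    rw [Real.mul_rpow hε0.le hSf0, Real.mul_rpow hK.le hSg0]
    ring
  refine (ENNReal.ofReal_le_ofReal h2).trans ?_
  have key {k S : ℝ} {m : ℝ≥0∞} (hk : 0 ≤ k)
      (hS : ENNReal.ofReal (S ^ q) ≤ ENNReal.ofReal C * m) :
      ENNReal.ofReal (2 ^ q * k ^ q * S ^ q) ≤ ENNReal.ofReal (2 ^ q * (k ^ q * C)) * m := by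
    rw [← mul_assoc (2 ^ q), ENNReal.ofReal_mul (by positivity),
      ENNReal.ofReal_mul (q := C) (by positivity), mul_assoc]
    gcongr
  rw [ENNReal.ofReal_add (by positivity) (by positivity), ← hεq]
  exact add_le_add (key hε0.le hSfC) (key hK.le hSgC)

/-- The total integral of (N f)^q may a priori be infinite, so absorption is done for the finite
integrals X n over discs. The bound on N f makes X n grow at most quadratically, which the
contraction factor 1/2 defeats. -/
theorem mem_weightedLp_of_eq_div_id_add {α : ℝ} (hα : 0 < α) {p : ℝ≥0∞} (hp : 0 < p)
    {f g : ℂ → ℂ} (hf : Differentiable ℂ f) (hgd : Differentiable ℂ g) {c : ℂ}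
    (hg : ∀ z : ℂ, z ≠ 0 → g z = deriv f z / z + c * (f z / z ^ 2)) (hgp : g ∈ weightedLp α p) :
    f ∈ weightedLp α p := by
  obtain ⟨G, hG⟩ := exists_gaussNorm_le_of_mem_weightedLp hα hp hgd hgp
  obtain ⟨M, hM⟩ := exists_gaussNorm_le_of_eq_div_id_add_of_le hα hf hg hG
  rcases eq_or_ne p ⊤ with rfl | hp'
  · exact (mem_weightedLp_top_iff α hf.continuous).2 ⟨M, hM⟩
  have hq := ENNReal.toReal_pos hp.ne' hp'
  rw [mem_weightedLp_iff_lintegral α hp.ne' hp' hgd.continuous] at hgp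
  rw [mem_weightedLp_iff_lintegral α hp.ne' hp' hf.continuous]
  set q := p.toReal
  have hM0 : 0 ≤ M := (gaussNorm_nonneg α f 0).trans (hM 0)
  set V := volume (Metric.ball (0 : ℂ) 2) with hV
  have hVtop : V ≠ ⊤ := measure_ball_lt_top.ne
  have hV0 : 0 < V.toReal :=
    ENNReal.toReal_pos (Metric.measure_ball_pos volume _ two_pos).ne' hVtop
  -- Averaging over discs of radius 2 costs a factor V, so this δ leaves exactly 1/2 in front of X
  -- (n + 1).
  obtain ⟨B, R, hB, hR, h⟩ := exists_gaussDensity_le_add_of_eq_div_id_add hα hq hf hgd hg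
    (δ := 1 / (2 * V.toReal)) (by positivity)
  -- The radii grow by 2, the radius of the discs in `localMass`, so the local masses over s n only
  -- see s (n + 1).
  set s : ℕ → Set ℂ := fun n => Metric.closedBall 0 (R + 2 * n) with hs
  have hsm (n : ℕ) : MeasurableSet (s n) := Metric.isClosed_closedBall.measurableSet
  set X : ℕ → ℝ≥0∞ := fun n => ∫⁻ z in s n, gaussDensity α q f z with hX
  set J := ∫⁻ z, gaussDensity α q g z
  have hXtop (n : ℕ) : X n ≠ ⊤ :=
    (setLIntegral_closedBall_gaussDensity_lt_top α hq hf.continuous _).ne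
  set A : ℝ≥0∞ := X 0 + ENNReal.ofReal B * (V * J) with hA
  have hAtop : A ≠ ⊤ := ENNReal.add_ne_top.2 ⟨hXtop 0, ENNReal.mul_ne_top ENNReal.ofReal_ne_top
    (ENNReal.mul_ne_top hVtop hgp.ne)⟩
  have hrec (n : ℕ) : X n ≤ A + ENNReal.ofReal (1 / (2 * V.toReal)) * (V * X (n + 1)) := by
    have hsub : s n ⊆ s 0 ∪ (s n \ s 0) := fun z hz => by
      by_cases hz0 : z ∈ s 0
      · exact Or.inl hz0
      · exact Or.inr ⟨hz, hz0⟩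
    have hout : ∫⁻ z in s n \ s 0, gaussDensity α q f z ≤
        ∫⁻ z in s n, (ENNReal.ofReal (1 / (2 * V.toReal)) * localMass α q f z +
          ENNReal.ofReal B * localMass α q g z) := by
      refine le_trans (setLIntegral_mono' ((hsm n).diff (hsm 0)) fun z hz => h z ?_)
        (lintegral_mono_set Set.sdiff_subset)
      simpa [hs] using hz.2
    have hsplit : ∫⁻ z in s n, (ENNReal.ofReal (1 / (2 * V.toReal)) * localMass α q f z +
          ENNReal.ofReal B * localMass α q g z) ≤
        ENNReal.ofReal (1 / (2 * V.toReal)) * (V * X (n + 1)) + ENNReal.ofReal B * (V * J) := by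
      rw [lintegral_add_left ((measurable_localMass α q hf.continuous).const_mul _),
        lintegral_const_mul' _ _ ENNReal.ofReal_ne_top,
        lintegral_const_mul' _ _ ENNReal.ofReal_ne_top]
      gcongr
      · refine (setLIntegral_closedBall_localMass_le α q hf.continuous _).trans_eq ?_
        simp only [hX, hs, hV]
        push_cast
        ring_nf
      · exact (setLIntegral_le_lintegral _ _).trans (lintegral_localMass_le α q hgd.continuous)
    calc X n ≤ ∫⁻ z in s 0 ∪ (s n \ s 0), gaussDensity α q f z := lintegral_mono_set hsub
      _ ≤ X 0 + ∫⁻ z in s n \ s 0, gaussDensity α q f z := lintegral_union_le _ _ _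
      _ ≤ X 0 + (ENNReal.ofReal (1 / (2 * V.toReal)) * (V * X (n + 1)) +
          ENNReal.ofReal B * (V * J)) := by gcongr; exact hout.trans hsplit
      _ = _ := by rw [hA]; ring
  have hrec' (n : ℕ) : (X n).toReal ≤ A.toReal + (X (n + 1)).toReal / 2 := by
    have h1 := ENNReal.toReal_mono (ENNReal.add_ne_top.2 ⟨hAtop,
      ENNReal.mul_ne_top ENNReal.ofReal_ne_top (ENNReal.mul_ne_top hVtop (hXtop (n + 1)))⟩) (hrec n)
    rw [ENNReal.toReal_add hAtop (ENNReal.mul_ne_top ENNReal.ofReal_ne_top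
      (ENNReal.mul_ne_top hVtop (hXtop (n + 1)))), ENNReal.toReal_mul, ENNReal.toReal_mul,
      ENNReal.toReal_ofReal (by positivity)] at h1
    refine h1.trans_eq ?_
    field_simp
  have hgrow (n : ℕ) : (X n).toReal ≤ M ^ q * ((R + 2) ^ 2 * Real.pi) * (n + 1 : ℝ) ^ 2 := by
    have h1 : X n ≤ ENNReal.ofReal (M ^ q) * volume (s n) :=
      setLIntegral_gaussDensity_le α hq (hsm n) fun z _ => hM z
    have h2 := ENNReal.toReal_mono
      (ENNReal.mul_ne_top ENNReal.ofReal_ne_top measure_closedBall_lt_top.ne) h1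
    rw [ENNReal.toReal_mul, ENNReal.toReal_ofReal (by positivity), Complex.volume_closedBall,
      ENNReal.toReal_mul, ENNReal.toReal_pow, ENNReal.toReal_ofReal (by positivity),
      ENNReal.coe_toReal, NNReal.coe_real_pi] at h2
    refine h2.trans ?_
    have h3 : (R + 2 * n) ^ 2 ≤ ((R + 2) * (n + 1 : ℝ)) ^ 2 := by
      gcongr
      have : 0 ≤ R * n := by positivity
      linarith
    calc M ^ q * ((R + 2 * n) ^ 2 * Real.pi)
        ≤ M ^ q * (((R + 2) * (n + 1 : ℝ)) ^ 2 * Real.pi) := by gcongr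
      _ = _ := by ring
  have hbound (n : ℕ) : X n ≤ ENNReal.ofReal (2 * A.toReal) := by
    rw [← ENNReal.ofReal_toReal (hXtop n)]
    exact ENNReal.ofReal_le_ofReal
      (le_two_mul_of_le_add_half_succ ENNReal.toReal_nonneg hrec' hgrow n)
  have hmono : Monotone s := fun m n hmn => Metric.closedBall_subset_closedBall (by gcongr)
  have hunion : ⋃ n, s n = Set.univ := Set.eq_univ_of_forall fun z => by
    obtain ⟨n, hn⟩ := exists_nat_ge ‖z‖
    refine Set.mem_iUnion.2 ⟨n, ?_⟩
    rw [hs, mem_closedBall_zero_iff]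
    have : (0 : ℝ) ≤ n := n.cast_nonneg
    linarith
  rw [← setLIntegral_univ, ← hunion, setLIntegral_iUnion_of_directed _ hmono.directed_le]
  exact (iSup_le hbound).trans_lt ENNReal.ofReal_lt_top

/-! ### The removable singularity and the equivalence -/

/-- Divided differences at 0 of entire functions are entire; the vanishing of f and f' at 0 reduces
them to f'/z and, after two steps, f/z². -/
theorem exists_differentiable_eq_div_id_add {f : ℂ → ℂ} (hf : Differentiable ℂ f)
    (hf0 : f 0 = 0) (hf1 : deriv f 0 = 0) (c : ℂ) :
    ∃ g : ℂ → ℂ, Differentiable ℂ g ∧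
      ∀ z : ℂ, z ≠ 0 → g z = deriv f z / z + c * (f z / z ^ 2) := by
  have hd {h : ℂ → ℂ} (hh : Differentiable ℂ h) : Differentiable ℂ (dslope h 0) := by
    rw [← differentiableOn_univ, Complex.differentiableOn_dslope Filter.univ_mem]
    exact hh.differentiableOn
  refine ⟨fun z => dslope (deriv f) 0 z + c * dslope (dslope f 0) 0 z,
    (hd hf.deriv).add ((hd (hd hf)).const_mul c), fun z hz => ?_⟩
  simp only [dslope_of_ne _ hz, slope_def_field, dslope_same, hf0, hf1, sub_zero]
  field_simp

/-- The function `f'(z)/z + c f(z)/z²` has a removable singularity at `0`; it is identified with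
the entire function `g` that agrees with it away from `0`. -/
theorem corollary10 (α : ℝ) (hα : 0 < α) (p : ℝ≥0∞) (hp : 0 < p) (f : ℂ → ℂ)
    (hf : Differentiable ℂ f) (hf0 : f 0 = 0) (hf1 : deriv f 0 = 0) (c : ℂ) :
    f ∈ fockSpace α p ↔
      ∃ g ∈ fockSpace α p, ∀ z : ℂ, z ≠ 0 → g z = deriv f z / z + c * (f z / z ^ 2) := by
  constructor
  · intro h
    obtain ⟨g, hgd, hg⟩ := exists_differentiable_eq_div_id_add hf hf0 hf1 c
    refine ⟨g, ⟨mem_weightedLp_of_local_bound hα hp hf hgd.continuous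
      (K := Real.exp (3 * α / 2) + ‖c‖) (R := 1) (by positivity) (fun z hz S _ hS => ?_) h.1,
      hgd⟩, hg⟩
    have hz0 : z ≠ 0 := norm_pos_iff.1 (one_pos.trans hz)
    have := gaussNorm_div_id_add_le hα hf c hz.le hS
    rwa [gaussNorm, ← hg z hz0, ← gaussNorm] at this
  · rintro ⟨g, hg, heq⟩
    exact ⟨mem_weightedLp_of_eq_div_id_add hα hp hf hg.2 heq hg.1, hf⟩
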